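/- Let $X$ be a Hausdorff topological space and $T:X\to X$ a continuous map. Let $N\ge 1$ be an integer and let $(\Lambda,T^N)$ be an $N$-order two-sided horseshoe of $(X,T)$, i.e. $\Lambda\subset X$ is a closed set with $T^N(\Lambda)\subset\Lambda$ and there is a homeomorphism $h:\Lambda\to\{0,1\}^{\mathbb Z}$ (product topology) with $h\circ T^N=\sigma\circ h$ on $\Lambda$, where $\sigma\big((x_m)_{m\in\mathbb Z}\big)=(x_{m+1})_{m\in\mathbb Z}$ is the two-sided full shift. Suppose that the horseshoe has disjoint steps, i.e. $\Lambda\cap T^k(\Lambda)=\emptyset$ for $1\le k\le N-1$. Put $$\Lambda^*=\bigcup_{k=0}^{N-1}T^k(\Lambda),$$ so that $T(\Lambda^*)\subset\Lambda^*$. Then for every integer $n\ge 2$ there is no continuous map $S:\Lambda^*\to\Lambda^*$ such that $S^n=T|_{\Lambda^*}$ (where $S^n$ is the $n$-th iterate of $S$). -/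

import Mathlib

open Set

/-- `(Λ, T^N)` is an `N`-order two-sided horseshoe of `(X, T)`: `N ≥ 1`, the set `Λ` is closed and
`T^N`-invariant, and the subsystem `(Λ, T^N)` is topologically conjugate to the two-sided full
shift on `{0,1}^ℤ`, where `{0,1}` is discrete and `(σ x)_m = x_{1 + m}`. -/
structure IsTwoSidedHorseshoe {X : Type*} [TopologicalSpace X] (T : X → X) (Λ : Set X) (N : ℕ) :
    Prop where
  one_le : 1 ≤ N
  isClosed : IsClosed Λ
  mapsTo : MapsTo T^[N] Λ Λ
  conj : ∃ h : Λ ≃ₜ (ℤ → Fin 2),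
    Function.Semiconj h (mapsTo.restrict T^[N] Λ Λ) (SymbolicDynamics.FullShift.shift (1 : ℤ))

/-- The steps `T^k(Λ)`, `1 ≤ k ≤ N - 1`, are disjoint from `Λ`. -/
def HasDisjointSteps {X : Type*} (T : X → X) (Λ : Set X) (N : ℕ) : Prop :=
  ∀ k : ℕ, 1 ≤ k → k < N → Disjoint Λ (T^[k] '' Λ)

/-- The set `Λ* = ⋃_{k=0}^{N-1} T^k(Λ)`. -/
def extendedHorseshoe {X : Type*} (T : X → X) (Λ : Set X) (N : ℕ) : Set X :=
  ⋃ k : Fin N, T^[k] '' Λ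

/-- `T` maps `Λ*` to itself. -/
theorem IsTwoSidedHorseshoe.mapsTo_extended {X : Type*} [TopologicalSpace X] {T : X → X}
    {Λ : Set X} {N : ℕ} (hΛ : IsTwoSidedHorseshoe T Λ N) :
    MapsTo T (extendedHorseshoe T Λ N) (extendedHorseshoe T Λ N) := by
  intro x hx
  obtain ⟨⟨k, hk⟩, y, hy, rfl⟩ := mem_iUnion.1 hx
  refine mem_iUnion.2 ?_
  rcases Nat.lt_or_ge (k + 1) N with h | h
  · exact ⟨⟨k + 1, h⟩, y, hy, Function.iterate_succ_apply' T k y⟩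
  · obtain rfl : N = k + 1 := by omega
    refine ⟨⟨0, hk.pos⟩, T (T^[k] y), ?_, rfl⟩
    rw [← Function.iterate_succ_apply' T k y]
    exact hΛ.mapsTo hy

open SymbolicDynamics.FullShift

/-! A root S commutes with T, and the full shift is transitive, so S carries Λ into a single step
T^j(Λ). Hence G = T^(N-j) ∘ S preserves Λ and becomes, on {0,1}^ℤ, a continuous map V commuting with
σ. Since G^n = T^((N-j)n+1), disjointness of the steps gives (N-j)n+1 = Nq, and then V^n = σ^q. If n
∣ q, then n ∣ 1, a contradiction.

The heart is therefore `dvd_of_iterate_eq_iterate_shift`. Both V and its inverse are sliding block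
codes, of a common radius r, so V sends a local stable set of level k to a finite union of local
stable sets of level k - r. Their number c does not depend on the set
(`exists_tailCount_image_tailClass_eq`), so V^n turns one set of level 0 into c^n sets of level -nr.
But σ^q turns it into one set of level -q, that is, 2^(nr-q) sets of level -nr. From c^n = 2^(nr-q)
it follows that c is a power of 2, so n ∣ nr - q and n ∣ q. -/

/-- The right tail `(x_k, x_{k+1}, …)` of a bi-infinite sequence. -/
def tail {α : Type*} (k : ℤ) (x : ℤ → α) : ℕ → α := fun i => x (k + i)

/-- The sequence `a t_0 t_1 …`. -/
def consTail {α : Type*} (a : α) (t : ℕ → α) : ℕ → α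
  | 0 => a
  | i + 1 => t i

/-- The local stable set of all sequences whose right tail from `k` on is `t`. -/
def tailClass {α : Type*} (k : ℤ) (t : ℕ → α) : Set (ℤ → α) := tail k ⁻¹' {t}

/-- `A` is a union of local stable sets of level `k`. -/
def TailSaturated {α : Type*} (k : ℤ) (A : Set (ℤ → α)) : Prop :=
  ∀ x ∈ A, ∀ y, tail k y = tail k x → y ∈ A

/-- The number of right tails from `k` on that occur in `A`. -/
noncomputable def tailCount {α : Type*} (k : ℤ) (A : Set (ℤ → α)) : ℕ := (tail k '' A).ncard

/-- Every coordinate of `V x` depends only on the coordinates of `x` at distance at most `r`. -/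
def HasRadius {α : Type*} (r : ℕ) (V : (ℤ → α) → (ℤ → α)) : Prop :=
  ∀ (x y : ℤ → α) (i : ℤ), (∀ j, i - r ≤ j → j ≤ i + r → x j = y j) → V x i = V y i

/-! ### Right tails and local stable sets. -/

section Tail

variable {α : Type*}

theorem tail_eq_tail_iff {k : ℤ} {x y : ℤ → α} :
    tail k x = tail k y ↔ ∀ i, k ≤ i → x i = y i := by
  constructor
  · intro h i hi
    have := congrFun h (i - k).toNat
    simp only [tail] at this
    rwa [show k + ((i - k).toNat : ℤ) = i by omega] at this
  · intro h
    funext i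
    exact h _ (by omega)

theorem tail_surjective (k : ℤ) : Function.Surjective (tail k : (ℤ → α) → ℕ → α) := fun t =>
  ⟨fun i => t (i - k).toNat, by funext i; simp [tail]⟩

theorem consTail_injective2 : Function.Injective2 (consTail (α := α)) := fun _ _ _ _ h =>
  ⟨congrFun h 0, funext fun i => congrFun h (i + 1)⟩

theorem tail_eq_consTail (k : ℤ) (x : ℤ → α) : tail k x = consTail (x k) (tail (k + 1) x) := by
  funext i
  cases i with
  | zero => simp [tail, consTail]
  | succ i => simp only [tail, consTail]; congr 1; push_cast; ring

theorem tail_shift (k : ℤ) (x : ℤ → α) : tail k (shift (1 : ℤ) x) = tail (k + 1) x := by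
  funext i
  simp only [tail, shift_apply]
  congr 1
  ring

theorem shift_bijective : Function.Bijective (shift (1 : ℤ) : (ℤ → α) → ℤ → α) := by
  refine ⟨fun x y h => funext fun i => ?_, fun x => ⟨fun i => x (i - 1), ?_⟩⟩
  · have := congrFun h (i - 1)
    simpa using this
  · funext i
    simp

theorem tailSaturated_tailClass (k : ℤ) (t : ℕ → α) : TailSaturated k (tailClass k t) :=
  fun _ hx _ hy => hy.trans hx

theorem TailSaturated.mono {k l : ℤ} (hlk : l ≤ k) {A : Set (ℤ → α)} (hA : TailSaturated k A) :
    TailSaturated l A := fun x hx y hy =>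
  hA x hx y (tail_eq_tail_iff.2 fun i hi => tail_eq_tail_iff.1 hy i (hlk.trans hi))

theorem tail_image_tailClass (k : ℤ) (t : ℕ → α) : tail k '' tailClass k t = {t} := by
  obtain ⟨x, hx⟩ := tail_surjective k t
  exact Subset.antisymm (by rintro _ ⟨y, hy, rfl⟩; exact hy)
    (by rintro _ rfl; exact ⟨x, hx, hx⟩)

theorem tail_image_subset (k : ℤ) (A : Set (ℤ → α)) :
    tail k '' A ⊆ image2 consTail univ (tail (k + 1) '' A) := by
  rintro _ ⟨x, hx, rfl⟩
  exact ⟨x k, mem_univ _, tail (k + 1) x, ⟨x, hx, rfl⟩, (tail_eq_consTail k x).symm⟩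

theorem TailSaturated.tail_image_eq {k : ℤ} {A : Set (ℤ → α)} (hA : TailSaturated (k + 1) A) :
    tail k '' A = image2 consTail univ (tail (k + 1) '' A) := by
  refine (tail_image_subset k A).antisymm ?_
  rintro _ ⟨a, -, _, ⟨x, hx, rfl⟩, rfl⟩
  have h : tail (k + 1) (Function.update x k a) = tail (k + 1) x :=
    tail_eq_tail_iff.2 fun i hi => Function.update_of_ne (by omega) _ _
  refine ⟨Function.update x k a, hA x hx _ h, ?_⟩
  rw [tail_eq_consTail, h, Function.update_self]

/-- Saturation at level `k + 1` leaves the symbol at `k` free. Finiteness is not needed: if there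
are infinitely many tails, both sides are 0 by the convention for `ncard`. -/
theorem TailSaturated.tailCount_eq {k : ℤ} {A : Set (ℤ → Fin 2)} (hA : TailSaturated (k + 1) A) :
    tailCount k A = 2 * tailCount (k + 1) A := by
  rw [tailCount, hA.tail_image_eq, ← image_uncurry_prod,
    ncard_image_of_injective _ consTail_injective2.uncurry, ncard_prod]
  simp [tailCount]

theorem TailSaturated.tailCount_sub {k : ℤ} {A : Set (ℤ → Fin 2)} (hA : TailSaturated k A)
    (j : ℕ) : tailCount (k - j) A = 2 ^ j * tailCount k A := by
  induction j with
  | zero => simp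
  | succ j ih =>
    have h : k - ((j + 1 : ℕ) : ℤ) + 1 = k - j := by push_cast; ring
    rw [TailSaturated.tailCount_eq (hA.mono (by omega)), h, ih, pow_succ]
    ring

theorem finite_tail_image_sub [Finite α] {k : ℤ} {A : Set (ℤ → α)} (hA : (tail k '' A).Finite)
    (j : ℕ) : (tail (k - j) '' A).Finite := by
  induction j with
  | zero => simpa using hA
  | succ j ih =>
    have h : k - ((j + 1 : ℕ) : ℤ) + 1 = k - j := by push_cast; ring
    refine Finite.subset ?_ (tail_image_subset _ _)
    rw [h]
    exact finite_univ.image2 _ ih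

theorem tailClass_succ (k : ℤ) (t : ℕ → α) :
    tailClass (k + 1) t = ⋃ a, tailClass k (consTail a t) := by
  ext x
  simp only [tailClass, mem_preimage, mem_singleton_iff, mem_iUnion, tail_eq_consTail k x]
  exact ⟨fun h => ⟨x k, by rw [h]⟩, fun ⟨a, h⟩ => (consTail_injective2 h).2⟩

theorem shift_image_tailClass (k : ℤ) (t : ℕ → α) :
    shift (1 : ℤ) '' tailClass (k + 1) t = tailClass k t := by
  ext x
  obtain ⟨y, rfl⟩ := shift_bijective.2 x
  rw [shift_bijective.1.mem_set_image]
  simp [tailClass, tail_shift]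

theorem iterate_shift_image_tailClass (q : ℕ) (k : ℤ) (t : ℕ → α) :
    (shift (1 : ℤ))^[q] '' tailClass k t = tailClass (k - q) t := by
  induction q with
  | zero => simp
  | succ q ih =>
    rw [Function.iterate_succ', image_comp, ih]
    convert shift_image_tailClass (k - ((q + 1 : ℕ) : ℤ)) t using 3
    push_cast
    ring

theorem tailCount_shift_image (k : ℤ) (A : Set (ℤ → α)) :
    tailCount k (shift (1 : ℤ) '' A) = tailCount (k + 1) A := by
  simp only [tailCount, image_image, tail_shift]

end Tail

/-! ### Images of local stable sets under sliding block codes. -/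

section Radius

variable {α : Type*} {r : ℕ}

theorem HasRadius.mono {s : ℕ} (hrs : r ≤ s) {V : (ℤ → α) → ℤ → α} (hV : HasRadius r V) :
    HasRadius s V := fun x y i h => hV x y i fun j h1 h2 => h j (by omega) (by omega)

theorem HasRadius.tail_eq {V : (ℤ → α) → ℤ → α} (hV : HasRadius r V) {k : ℤ} {x y : ℤ → α}
    (h : tail (k - r) x = tail (k - r) y) : tail k (V x) = tail k (V y) :=
  tail_eq_tail_iff.2 fun i hi => hV x y i fun j hj _ =>
    tail_eq_tail_iff.1 h j (by omega)

variable {V : (ℤ → α) ≃ (ℤ → α)}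

theorem HasRadius.tail_eq_of_symm (hV' : HasRadius r V.symm) {k : ℤ} {x y : ℤ → α}
    (h : tail (k - r) (V x) = tail (k - r) (V y)) : tail k x = tail k y := by
  simpa using hV'.tail_eq h

theorem HasRadius.tailSaturated_image (hV' : HasRadius r V.symm) {k : ℤ} {A : Set (ℤ → α)}
    (hA : TailSaturated k A) : TailSaturated (k - r) (V '' A) := by
  rintro _ ⟨x, hx, rfl⟩ y hy
  refine ⟨V.symm y, hA x hx _ (hV'.tail_eq_of_symm ?_), by simp⟩
  simpa using hy

/-- All points of the image share their tail from `k + r` on, so only the `2 * r` symbols before it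
can vary. -/
theorem HasRadius.finite_tail_image_tailClass [Finite α] (hV : HasRadius r V) (k : ℤ) (t : ℕ → α) :
    (tail (k - r) '' (V '' tailClass k t)).Finite := by
  have h : (tail (k + r) '' (V '' tailClass k t)).Finite := by
    refine Subsingleton.finite ?_
    rintro _ ⟨_, ⟨x, hx, rfl⟩, rfl⟩ _ ⟨_, ⟨y, hy, rfl⟩, rfl⟩
    refine hV.tail_eq ?_
    rw [add_sub_cancel_right]
    exact hx.trans hy.symm
  have := finite_tail_image_sub h (2 * r)
  rwa [show k + r - ((2 * r : ℕ) : ℤ) = k - r by push_cast; ring] at this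

theorem HasRadius.disjoint_tail_image (hV' : HasRadius r V.symm) {k : ℤ} {s t : ℕ → α}
    (hst : s ≠ t) : Disjoint (tail (k - r) '' (V '' tailClass k s))
      (tail (k - r) '' (V '' tailClass k t)) := by
  rw [Set.disjoint_left]
  rintro _ ⟨_, ⟨x, hx, rfl⟩, rfl⟩ ⟨_, ⟨y, hy, rfl⟩, h⟩
  exact hst (hx.symm.trans ((hV'.tail_eq_of_symm h).symm.trans hy))

theorem tailCount_image_tailClass_succ (hσ : ∀ x, V (shift (1 : ℤ) x) = shift (1 : ℤ) (V x))
    (k : ℤ) (t : ℕ → α) : tailCount (k + 1 - r) (V '' tailClass (k + 1) t) =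
      tailCount (k - r) (V '' tailClass k t) := by
  rw [← shift_image_tailClass k t, image_image, show (k : ℤ) + 1 - r = k - r + 1 by ring,
    ← tailCount_shift_image, image_image]
  simp only [hσ]

theorem tailCount_image_tailClass_eq (hσ : ∀ x, V (shift (1 : ℤ) x) = shift (1 : ℤ) (V x))
    (k : ℤ) (t : ℕ → α) : tailCount (k - r) (V '' tailClass k t) =
      tailCount (0 - r) (V '' tailClass 0 t) := by
  induction k using Int.induction_on with
  | zero => rfl
  | succ i ih => rw [tailCount_image_tailClass_succ hσ, ih]
  | pred i ih =>
    rw [← ih, ← tailCount_image_tailClass_succ hσ (-(i : ℤ) - 1)]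
    simp

/-- Beyond coordinate `r` the image tail is fixed, so the count is that of the words on `[-r, r)`.
These words read only coordinates in `[-2r, 2r)`: the negative ones are free, the others are the
first `2 * r` symbols of `t`. -/
theorem tailCount_image_tailClass_congr (hV : HasRadius r V) {t t' : ℕ → α}
    (h : ∀ i < 2 * r, t i = t' i) : tailCount (0 - r) (V '' tailClass 0 t) =
      tailCount (0 - r) (V '' tailClass 0 t') := by
  let F : (ℕ → α) → (Fin (2 * r) → α) := fun u i => u i
  have hinj : ∀ u, InjOn F (tail (0 - r) '' (V '' tailClass 0 u)) := by
    rintro u _ ⟨_, ⟨x, hx, rfl⟩, rfl⟩ _ ⟨_, ⟨y, hy, rfl⟩, rfl⟩ hF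
    have h1 : tail (r : ℤ) (V x) = tail (r : ℤ) (V y) := hV.tail_eq (by
      rw [sub_self]; exact hx.trans hy.symm)
    refine tail_eq_tail_iff.2 fun i hi => ?_
    by_cases hir : (r : ℤ) ≤ i
    · exact tail_eq_tail_iff.1 h1 i hir
    · have := congrFun hF ⟨(i + r).toNat, by omega⟩
      simp only [F, tail] at this
      rwa [show (0 : ℤ) - r + ((i + r).toNat : ℤ) = i by omega] at this
  have hsub : ∀ u u' : ℕ → α, (∀ i < 2 * r, u i = u' i) →
      F '' (tail (0 - r) '' (V '' tailClass 0 u)) ⊆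
        F '' (tail (0 - r) '' (V '' tailClass 0 u')) := by
    rintro u u' huu _ ⟨_, ⟨_, ⟨x, hx, rfl⟩, rfl⟩, rfl⟩
    -- Keep the past of `x` and replace its future by `u'`; the window that matters does not see the
    -- change.
    let y : ℤ → α := fun i => if i < 0 then x i else u' i.toNat
    have hy : y ∈ tailClass 0 u' := by
      simp only [tailClass, mem_preimage, mem_singleton_iff]
      funext i
      simp [tail, y]
    refine ⟨_, ⟨_, ⟨y, hy, rfl⟩, rfl⟩, funext fun i => ?_⟩
    refine hV y x (0 - r + i) fun j hj1 hj2 => ?_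
    have hi := i.2
    by_cases hj : j < 0
    · simp [y, hj]
    · simp only [y, hj, if_false]
      rw [← huu _ (by omega)]
      have := congrFun hx j.toNat
      simp only [tail] at this
      rw [← this]
      congr 1
      omega
  rw [tailCount, tailCount, ← (hinj t).ncard_image, ← (hinj t').ncard_image]
  exact congrArg ncard ((hsub t t' h).antisymm (hsub t' t fun i hi => (h i hi).symm))

end Radius

/-! ### The multiplier of an automorphism and the divisibility it forces. -/

section Multiplier

variable {r : ℕ} {V : (ℤ → Fin 2) ≃ (ℤ → Fin 2)}

/-- A class of level 1 splits into two classes of level 0, whose images have disjoint tail sets;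
lowering the counting level by one doubles the count, and equivariance identifies level 1 with level
0. -/
theorem tailCount_image_tailClass_average (hV : HasRadius r V) (hV' : HasRadius r V.symm)
    (hσ : ∀ x, V (shift (1 : ℤ) x) = shift (1 : ℤ) (V x)) (t : ℕ → Fin 2) :
    2 * tailCount (0 - r) (V '' tailClass 0 t) =
      tailCount (0 - r) (V '' tailClass 0 (consTail 0 t)) +
        tailCount (0 - r) (V '' tailClass 0 (consTail 1 t)) := by
  have h0 : tailCount (0 - r) (V '' tailClass (0 + 1) t) =
      2 * tailCount (0 + 1 - r) (V '' tailClass (0 + 1) t) := by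
    have hs := hV'.tailSaturated_image (tailSaturated_tailClass (0 + 1) t)
    rw [show (0 : ℤ) + 1 - r = 0 - r + 1 by ring] at hs ⊢
    exact hs.tailCount_eq
  rw [← tailCount_image_tailClass_eq hσ (0 + 1) t, ← h0, tailClass_succ, tailCount, image_iUnion,
    image_iUnion, tailCount, tailCount, ← ncard_union_eq (hV'.disjoint_tail_image ?_)
      (hV.finite_tail_image_tailClass 0 _) (hV.finite_tail_image_tailClass 0 _)]
  · congr 1
    ext u
    simp only [mem_iUnion, mem_union, Fin.exists_fin_two]
  · intro h
    exact absurd (consTail_injective2 h).1 (by decide)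

/-- Maximum principle: the count takes finitely many values, and its value at `t` is the mean of
those at `0t` and `1t`. So a maximum at `t` passes to every sequence obtained by prepending symbols
to `t`. -/
theorem exists_tailCount_image_tailClass_eq (hV : HasRadius r V) (hV' : HasRadius r V.symm)
    (hσ : ∀ x, V (shift (1 : ℤ) x) = shift (1 : ℤ) (V x)) :
    ∃ c, ∀ k t, tailCount (k - r) (V '' tailClass k t) = c := by
  set g : (ℕ → Fin 2) → ℕ := fun t => tailCount (0 - r) (V '' tailClass 0 t) with hg
  have hloc : ∀ t t' : ℕ → Fin 2, (∀ i < 2 * r, t i = t' i) → g t = g t' := fun t t' h =>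
    tailCount_image_tailClass_congr hV h
  let ext : (Fin (2 * r) → Fin 2) → ℕ → Fin 2 := fun w i => if h : i < 2 * r then w ⟨i, h⟩ else 0
  obtain ⟨w, hw⟩ := Finite.exists_max (g ∘ ext)
  have hmax : ∀ t, g t ≤ g (ext w) := fun t => by
    refine le_of_eq_of_le (hloc t (ext fun i => t i) fun i hi => ?_) (hw fun i => t i)
    simp [ext, hi]
  have hind : ∀ j : ℕ, ∀ t, (∀ i, t (i + j) = ext w i) → g t = g (ext w) := by
    intro j
    induction j with
    | zero => exact fun t ht => congrArg g (funext ht)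
    | succ j ih =>
      intro t ht
      have h1 := ih (fun i => t (i + 1)) fun i => by rw [← ht i]; congr 1
      have h2 : 2 * g (fun i => t (i + 1)) = g (consTail 0 fun i => t (i + 1)) +
        g (consTail 1 fun i => t (i + 1)) := tailCount_image_tailClass_average hV hV' hσ _
      have h3 := hmax (consTail 0 fun i => t (i + 1))
      have h4 := hmax (consTail 1 fun i => t (i + 1))
      have h5 : t = consTail (t 0) fun i => t (i + 1) := by
        funext i
        cases i <;> rfl
      rw [h5]
      have h6 : t 0 = 0 ∨ t 0 = 1 := by omega
      rcases h6 with h6 | h6 <;> rw [h6] <;> omega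
  refine ⟨g (ext w), fun k t => ?_⟩
  rw [tailCount_image_tailClass_eq hσ k t]
  -- Splice the first `2 * r` symbols of `t`, which alone determine the count, onto the maximizer.
  rw [← hind (2 * r) (fun i => if i < 2 * r then t i else ext w (i - 2 * r)) fun i => by simp]
  exact hloc _ _ fun i hi => by simp [hi]

theorem tailCount_image (hV : HasRadius r V) (hV' : HasRadius r V.symm) {c : ℕ}
    (hc : ∀ k t, tailCount (k - r) (V '' tailClass k t) = c) {k : ℤ} {A : Set (ℤ → Fin 2)}
    (hA : TailSaturated k A) (hfin : (tail k '' A).Finite) :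
    (tail (k - r) '' (V '' A)).Finite ∧ tailCount (k - r) (V '' A) = c * tailCount k A := by
  classical
  have hU : A = ⋃ t ∈ tail k '' A, tailClass k t := by
    ext x
    simp only [mem_iUnion, tailClass, mem_preimage, mem_singleton_iff, exists_prop]
    exact ⟨fun hx => ⟨_, mem_image_of_mem _ hx, rfl⟩, by
      rintro ⟨_, ⟨y, hy, rfl⟩, h⟩
      exact hA y hy x h⟩
  have hB : tail (k - r) '' (V '' A) =
      ⋃ t ∈ hfin.toFinset, tail (k - r) '' (V '' tailClass k t) := by
    conv_lhs => rw [hU]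
    simp only [image_iUnion, Finite.mem_toFinset]
  have hf := fun t => hV.finite_tail_image_tailClass k t
  have hB' : tail (k - r) '' (V '' A) =
      ((hfin.toFinset.biUnion fun t => (hf t).toFinset : Finset (ℕ → Fin 2)) : Set _) := by
    rw [hB]
    simp
  refine ⟨hB' ▸ Finset.finite_toSet _, ?_⟩
  rw [tailCount, hB', ncard_coe_finset, Finset.card_biUnion]
  · rw [Finset.sum_congr rfl fun t _ => (ncard_eq_toFinset_card _ (hf t)).symm.trans (hc k t),
      Finset.sum_const, smul_eq_mul, mul_comm, tailCount, ncard_eq_toFinset_card _ hfin]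
  · intro s _ t _ hst
    simpa [Function.onFun] using hV'.disjoint_tail_image (k := k) hst

theorem tailCount_iterate_image (hV : HasRadius r V) (hV' : HasRadius r V.symm) {c : ℕ}
    (hc : ∀ k t, tailCount (k - r) (V '' tailClass k t) = c) {k : ℤ} {A : Set (ℤ → Fin 2)}
    (hA : TailSaturated k A) (hfin : (tail k '' A).Finite) (n : ℕ) :
    TailSaturated (k - (n * r : ℕ)) (V^[n] '' A) ∧ (tail (k - (n * r : ℕ)) '' (V^[n] '' A)).Finite ∧
      tailCount (k - (n * r : ℕ)) (V^[n] '' A) = c ^ n * tailCount k A := by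
  induction n with
  | zero => simpa using ⟨hA, hfin⟩
  | succ n ih =>
    obtain ⟨h1, h2, h3⟩ := ih
    have h4 := hV'.tailSaturated_image h1
    obtain ⟨h5, h6⟩ := tailCount_image hV hV' hc h1 h2
    rw [show k - ((n + 1) * r : ℕ) = k - (n * r : ℕ) - r by push_cast; ring,
      Function.iterate_succ', image_comp]
    exact ⟨h4, h5, by rw [h6, h3]; ring⟩

theorem dvd_of_iterate_eq_iterate_shift_of_hasRadius (hV : HasRadius r V)
    (hV' : HasRadius r V.symm) (hσ : ∀ x, V (shift (1 : ℤ) x) = shift (1 : ℤ) (V x)) {n q : ℕ}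
    (hqr : q ≤ n * r) (h : V^[n] = (shift (1 : ℤ))^[q]) : n ∣ q := by
  obtain ⟨c, hc⟩ := exists_tailCount_image_tailClass_eq hV hV' hσ
  let t : ℕ → Fin 2 := 0
  have h1 : tailCount 0 (tailClass 0 t) = 1 := by
    rw [tailCount, tail_image_tailClass, ncard_singleton]
  have h2 : tailCount (0 - (q : ℤ)) (tailClass (0 - q) t) = 1 := by
    rw [tailCount, tail_image_tailClass, ncard_singleton]
  have h3 := (tailCount_iterate_image hV hV' hc (tailSaturated_tailClass 0 t)
    (by rw [tail_image_tailClass]; exact finite_singleton _) n).2.2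
  have h4 := (tailSaturated_tailClass (0 - (q : ℤ)) t).tailCount_sub (n * r - q)
  rw [h, iterate_shift_image_tailClass, h1, mul_one,
    show (0 : ℤ) - (n * r : ℕ) = 0 - q - (n * r - q : ℕ) by omega, h4, h2, mul_one] at h3
  rcases Nat.eq_zero_or_pos n with rfl | hn
  · simp at hqr
    simp [hqr]
  -- Here `h3` says that 2^(nr-q) = c^n.
  obtain ⟨a, -, rfl⟩ := (Nat.dvd_prime_pow Nat.prime_two).1 (h3 ▸ dvd_pow_self c hn.ne')
  rw [← pow_mul] at h3
  have h5 := Nat.pow_right_injective le_rfl h3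
  have h6 : n ∣ n * r - q := ⟨a, by rw [h5, mul_comm]⟩
  exact (Nat.dvd_sub_iff_right hqr (dvd_mul_right n r)).1 h6

end Multiplier

/-! ### Transitivity of the shift and continuity as finite radius. -/

section Continuity

variable {α : Type*}

theorem map_shift_of_map_shift_one {V : (ℤ → α) → ℤ → α}
    (hσ : ∀ x, V (shift (1 : ℤ) x) = shift (1 : ℤ) (V x)) (i : ℤ) (x : ℤ → α) :
    V (shift i x) = shift i (V x) := by
  induction i using Int.induction_on generalizing x with
  | zero => simp
  | succ i ih => rw [shift_add, hσ, ih, shift_add]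
  | pred i ih =>
    apply shift_bijective.1
    rw [← hσ, ← shift_add, ← shift_add, sub_add_cancel, ih]

variable [TopologicalSpace α]

theorem exists_forall_eqOn_Icc_imp_mem {s : Set (ℤ → α)} (hs : IsOpen s) {x : ℤ → α} (hx : x ∈ s) :
    ∃ L : ℕ, ∀ y : ℤ → α, (∀ i, -(L : ℤ) ≤ i → i ≤ L → y i = x i) → y ∈ s := by
  obtain ⟨I, u, hu, hI⟩ := isOpen_pi_iff.1 hs x hx
  refine ⟨I.sup Int.natAbs, fun y hy => hI fun i hi => ?_⟩
  have : i.natAbs ≤ I.sup Int.natAbs := Finset.le_sup (f := Int.natAbs) hi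
  rw [hy i (by omega) (by omega)]
  exact (hu i hi).2

/-- A closed and open set that the shift maps to itself is trivial. -/
theorem eq_univ_of_isClopen_of_mapsTo_shift {A : Set (ℤ → α)} (hA : IsClopen A)
    (hne : A.Nonempty) (hσ : MapsTo (shift (1 : ℤ)) A A) : A = univ := by
  obtain ⟨x, hx⟩ := hne
  refine eq_univ_of_forall fun y => ?_
  by_contra hy
  obtain ⟨L, hL⟩ := exists_forall_eqOn_Icc_imp_mem hA.isOpen hx
  obtain ⟨M, hM⟩ := exists_forall_eqOn_Icc_imp_mem hA.compl.isOpen hy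
  -- The point `z` looks like `x` on `[-L, L]`, and like `y` on `[-M, M]` after `L + M + 1` shifts,
  -- so its orbit would leave `A`.
  let z : ℤ → α := fun i => if i ≤ L then x i else y (i - (L + M + 1))
  have hz : z ∈ A := hL z fun i _ h2 => if_pos h2
  have hshift : ∀ (j : ℕ) (w : ℤ → α), (shift (1 : ℤ))^[j] w = fun i => w (j + i) := by
    intro j
    induction j with
    | zero => simp
    | succ j ih =>
      intro w
      rw [Function.iterate_succ_apply', ih]
      funext i
      simp only [shift_apply]
      congr 1
      push_cast
      ring
  have hzj := hσ.iterate (L + M + 1) hz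
  rw [hshift] at hzj
  refine hM _ (fun i h1 h2 => ?_) hzj
  simp only [z]
  rw [if_neg (by push_cast; omega)]
  congr 1
  push_cast
  ring

variable [DiscreteTopology α]

theorem isOpen_setOf_eqOn_Icc (x : ℤ → α) (L : ℕ) :
    IsOpen {y : ℤ → α | ∀ i, -(L : ℤ) ≤ i → i ≤ L → y i = x i} := by
  have : {y : ℤ → α | ∀ i, -(L : ℤ) ≤ i → i ≤ L → y i = x i} =
      (Icc (-(L : ℤ)) L).pi fun i => {x i} := by
    ext y
    simp [Set.mem_pi]
  rw [this]
  exact isOpen_set_pi (finite_Icc _ _) fun i _ => isOpen_discrete _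

/-- Local constancy gives a window at each point; compactness makes one window serve all points. -/
theorem exists_forall_eqOn_Icc_imp_eq [Finite α] {β : Type*} [TopologicalSpace β]
    [DiscreteTopology β] {f : (ℤ → α) → β} (hf : Continuous f) :
    ∃ L : ℕ, ∀ x y : ℤ → α, (∀ i, -(L : ℤ) ≤ i → i ≤ L → y i = x i) → f y = f x := by
  let U : ℕ → Set (ℤ → α) := fun L =>
    {x | ∀ y : ℤ → α, (∀ i, -(L : ℤ) ≤ i → i ≤ L → y i = x i) → f y = f x}
  have hU : ∀ L, IsOpen (U L) := fun L => isOpen_iff_forall_mem_open.2 fun x hx =>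
    ⟨{y | ∀ i, -(L : ℤ) ≤ i → i ≤ L → y i = x i}, fun y hy z hz =>
      (hx z fun i h1 h2 => (hz i h1 h2).trans (hy i h1 h2)).trans (hx y hy).symm,
      isOpen_setOf_eqOn_Icc x L, fun _ _ _ => rfl⟩
  have hcov : (univ : Set (ℤ → α)) ⊆ ⋃ L, U L := fun x _ => by
    obtain ⟨L, hL⟩ := exists_forall_eqOn_Icc_imp_mem
      ((isOpen_discrete {f x}).preimage hf) (x := x) rfl
    exact mem_iUnion.2 ⟨L, hL⟩
  have hmono : Monotone U := fun L M hLM x hx y hy =>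
    hx y fun i h1 h2 => hy i (by omega) (by omega)
  obtain ⟨L, hL⟩ := isCompact_univ.elim_directed_cover U hU hcov hmono.directed_le
  exact ⟨L, fun x => hL (mem_univ x)⟩

/-- The Curtis-Hedlund-Lyndon theorem. -/
theorem exists_hasRadius [Finite α] {V : (ℤ → α) → ℤ → α} (hV : Continuous V)
    (hσ : ∀ x, V (shift (1 : ℤ) x) = shift (1 : ℤ) (V x)) : ∃ r, HasRadius r V := by
  obtain ⟨r, hr⟩ := exists_forall_eqOn_Icc_imp_eq ((continuous_apply (0 : ℤ)).comp hV)
  refine ⟨r, fun x y i h => ?_⟩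
  have := hr (shift i y) (shift i x) fun j h1 h2 => h (i + j) (by omega) (by omega)
  simpa [map_shift_of_map_shift_one hσ] using this

end Continuity

/-- If a power of the two-sided full `2`-shift has a continuous `n`-th root commuting with the
shift, then `n` divides the exponent. -/
theorem dvd_of_iterate_eq_iterate_shift {V : (ℤ → Fin 2) → ℤ → Fin 2} (hV : Continuous V)
    (hσ : ∀ x, V (shift (1 : ℤ) x) = shift (1 : ℤ) (V x)) {n q : ℕ} (hn : n ≠ 0)
    (h : V^[n] = (shift (1 : ℤ))^[q]) : n ∣ q := by
  have hbij : Function.Bijective V := by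
    have hq : Function.Bijective V^[n] := h ▸ shift_bijective.iterate q
    obtain ⟨m, rfl⟩ := Nat.exists_eq_succ_of_ne_zero hn
    refine ⟨Function.Injective.of_comp (f := V^[m]) ?_, Function.Surjective.of_comp (g := V^[m]) ?_⟩
    · rw [← Function.iterate_succ]; exact hq.1
    · rw [← Function.iterate_succ']; exact hq.2
  let e : (ℤ → Fin 2) ≃ (ℤ → Fin 2) := Equiv.ofBijective V hbij
  have he : Continuous e.symm := (Continuous.homeoOfEquivCompactToT2 (f := e) hV).symm.continuous
  have hσ' : ∀ x, e.symm (shift (1 : ℤ) x) = shift (1 : ℤ) (e.symm x) := fun x => by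
    rw [Equiv.symm_apply_eq]
    refine Eq.trans ?_ (hσ _).symm
    exact congrArg _ (e.apply_symm_apply x).symm
  obtain ⟨r, hr⟩ := exists_hasRadius hV hσ
  obtain ⟨s, hs⟩ := exists_hasRadius he hσ'
  -- The radius must serve both `V` and its inverse; adding `q` ensures `q ≤ n * r`, so that level
  -- -q lies above level -nr.
  refine dvd_of_iterate_eq_iterate_shift_of_hasRadius (V := e) (r := r + s + q)
    (HasRadius.mono (by omega) hr) (hs.mono (by omega)) hσ ?_ h
  exact (Nat.le_add_left q (r + s)).trans (Nat.le_mul_of_pos_left _ (Nat.pos_of_ne_zero hn))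

/-! ### The steps of the horseshoe. -/

section Horseshoe

variable {X : Type*} {T : X → X} {Λ : Set X} {N : ℕ}

theorem HasDisjointSteps.disjoint_image (hdisj : HasDisjointSteps T Λ N)
    (hmaps : MapsTo T^[N] Λ Λ) {i j : ℕ} (hij : i < j) (hj : j < N) :
    Disjoint (T^[i] '' Λ) (T^[j] '' Λ) := by
  rw [Set.disjoint_left]
  rintro _ ⟨x, hx, rfl⟩ ⟨y, hy, h⟩
  refine Set.disjoint_left.1 (hdisj (j - i) (by omega) (by omega)) (hmaps hx)
    ⟨T^[N] y, hmaps hy, ?_⟩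
  -- Pushing forward by `N - i` returns the first point to Λ and puts the second in step `j - i`.
  have := congrArg T^[N - i] h
  simp only [← Function.iterate_add_apply] at this ⊢
  rwa [show N - i + i = N by omega, show N - i + j = j - i + N by omega] at this

theorem HasDisjointSteps.dvd_of_iterate_mem (hdisj : HasDisjointSteps T Λ N)
    (hmaps : MapsTo T^[N] Λ Λ) (hN : 1 ≤ N) {x : X} (hx : x ∈ Λ) {m : ℕ} (hm : T^[m] x ∈ Λ) :
    N ∣ m := by
  by_contra h
  refine Set.disjoint_left.1 (hdisj (m % N) (Nat.pos_of_ne_zero fun h0 =>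
    h (Nat.dvd_of_mod_eq_zero h0)) (Nat.mod_lt _ hN)) hm ⟨(T^[N])^[m / N] x, hmaps.iterate _ hx, ?_⟩
  rw [← Function.iterate_mul, ← Function.iterate_add_apply, Nat.mod_add_div]

theorem mapsTo_iterate_image (hmaps : MapsTo T^[N] Λ Λ) (j : ℕ) :
    MapsTo T^[N] (T^[j] '' Λ) (T^[j] '' Λ) := by
  rintro _ ⟨y, hy, rfl⟩
  exact ⟨T^[N] y, hmaps hy, (Function.Commute.iterate_iterate_self T j N).eq y⟩

/-- The steps are compact, hence closed, and each is the complement in Λ* of the finite union of the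
others. -/
theorem isClopen_preimage_step [TopologicalSpace X] [T2Space X] (hT : Continuous T)
    (hΛ : IsCompact Λ) (hmaps : MapsTo T^[N] Λ Λ) (hdisj : HasDisjointSteps T Λ N) (j : Fin N) :
    IsClopen ((↑) ⁻¹' (T^[j] '' Λ) : Set (extendedHorseshoe T Λ N)) := by
  have hcl : ∀ k : Fin N, IsClosed ((↑) ⁻¹' (T^[k] '' Λ) : Set (extendedHorseshoe T Λ N)) :=
    fun k => (hΛ.image (hT.iterate k)).isClosed.preimage continuous_subtype_val
  refine ⟨hcl j, ?_⟩
  have : ((↑) ⁻¹' (T^[j] '' Λ) : Set (extendedHorseshoe T Λ N)) =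
      (⋃ k ∈ ({j}ᶜ : Set (Fin N)), ((↑) ⁻¹' (T^[k] '' Λ)))ᶜ := by
    ext ⟨x, hx⟩
    obtain ⟨i, hi⟩ := mem_iUnion.1 hx
    simp only [mem_preimage, mem_compl_iff, mem_iUnion, mem_singleton_iff, not_exists]
    constructor
    · intro hj k hk hxk
      rcases lt_or_gt_of_ne hk with h | h
      · exact Set.disjoint_left.1 (hdisj.disjoint_image hmaps h j.2) hxk hj
      · exact Set.disjoint_left.1 (hdisj.disjoint_image hmaps h k.2) hj hxk
    · intro h
      by_contra hj
      exact h i (fun hij => hj (hij ▸ hi)) hi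
  rw [this]
  exact ((toFinite _).isClosed_biUnion fun k _ => hcl k).isOpen_compl

end Horseshoe

/-! ### Reduction to roots of shift powers. -/

theorem proposition6p1 {X : Type*} [TopologicalSpace X] [T2Space X] (T : X → X)
    (hT : Continuous T) (Λ : Set X) (N : ℕ) (hΛ : IsTwoSidedHorseshoe T Λ N)
    (hdisj : HasDisjointSteps T Λ N) (n : ℕ) (hn : 2 ≤ n) :
    ¬ ∃ S : extendedHorseshoe T Λ N → extendedHorseshoe T Λ N, Continuous S ∧
      S^[n] = hΛ.mapsTo_extended.restrict T
        (extendedHorseshoe T Λ N) (extendedHorseshoe T Λ N) := by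
  rintro ⟨S, hS, hSn⟩
  obtain ⟨h, hconj⟩ := hΛ.conj
  have hN := hΛ.one_le
  have hmaps := hΛ.mapsTo
  set R := hΛ.mapsTo_extended.restrict T (extendedHorseshoe T Λ N) (extendedHorseshoe T Λ N)
    with hR
  have hRT : ∀ k x, ((R^[k] x : extendedHorseshoe T Λ N) : X) = T^[k] x := fun k =>
    Function.Semiconj.iterate_right (f := Subtype.val) (fun _ => rfl) k
  have hRcont : Continuous R := hT.restrict hΛ.mapsTo_extended
  have hSR : Function.Commute S R := hSn ▸ Function.Commute.self_iterate S n
  have hsub : Λ ⊆ extendedHorseshoe T Λ N := fun x hx =>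
    mem_iUnion.2 ⟨⟨0, hN⟩, x, hx, rfl⟩
  let ι : (ℤ → Fin 2) → extendedHorseshoe T Λ N := fun x => inclusion hsub (h.symm x)
  have hι : Continuous ι := (continuous_inclusion hsub).comp h.symm.continuous
  have hιinj : Function.Injective ι := (inclusion_injective hsub).comp h.symm.injective
  have hιΛ : ∀ x, (ι x : X) ∈ Λ := fun x => (h.symm x).2
  have hισ : Function.Semiconj ι (shift (1 : ℤ)) R^[N] := fun x => by
    have h1 : h.symm (shift (1 : ℤ) x) = hmaps.restrict T^[N] Λ Λ (h.symm x) := by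
      rw [Homeomorph.symm_apply_eq, hconj.eq, Homeomorph.apply_symm_apply]
    apply Subtype.ext
    rw [hRT]
    exact congrArg Subtype.val h1
  have hcompact : IsCompact Λ := by
    rw [isCompact_iff_compactSpace]
    exact h.symm.compactSpace
  obtain ⟨j, hj⟩ := mem_iUnion.1 (S (ι 0)).2
  -- The points sent by `S` to step `j` form a nonempty clopen shift-invariant set, hence
  -- everything.
  have hSj : ∀ x, (S (ι x) : X) ∈ T^[j] '' Λ := by
    have := eq_univ_of_isClopen_of_mapsTo_shift
      ((isClopen_preimage_step hT hcompact hmaps hdisj j).preimage (hS.comp hι)) ⟨0, hj⟩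
      fun x hx => by
        simp only [mem_preimage, Function.comp_apply] at hx ⊢
        rw [hισ.eq, (hSR.iterate_right N).eq, hRT]
        exact mapsTo_iterate_image hmaps j hx
    exact fun x => (this ▸ mem_univ x : x ∈ _)
  let G : extendedHorseshoe T Λ N → extendedHorseshoe T Λ N := R^[N - j] ∘ S
  have hGcont : Continuous G := (hRcont.iterate _).comp hS
  have hG : ∀ x, (G (ι x) : X) ∈ Λ := fun x => by
    obtain ⟨y, hy, hxy⟩ := hSj x
    simp only [G, Function.comp_apply, hRT, ← hxy]
    rw [← Function.iterate_add_apply, Nat.sub_add_cancel j.2.le]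
    exact hmaps hy
  let V : (ℤ → Fin 2) → ℤ → Fin 2 := fun x => h ⟨G (ι x), hG x⟩
  have hV : Continuous V := h.continuous.comp
    ((continuous_subtype_val.comp (hGcont.comp hι)).subtype_mk _)
  have hιV : Function.Semiconj ι V G := fun x => by
    apply Subtype.ext
    simp [ι, V]
  have hRS : ∀ k, Function.Commute R^[k] S := fun k => (hSR.iterate_right k).symm
  have hVσ : ∀ x, V (shift (1 : ℤ) x) = shift (1 : ℤ) (V x) := fun x => by
    apply hιinj
    rw [hιV.eq, hισ.eq, hισ.eq, hιV.eq]
    exact ((Function.Commute.iterate_iterate_self R (N - j) N).comp_left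
      (hSR.iterate_right N)).eq _
  have hGn : G^[n] = R^[(N - j) * n + 1] := by
    rw [(hRS (N - j)).comp_iterate, hSn, ← Function.iterate_mul, Function.iterate_succ]
  -- An orbit starting in Λ is in Λ only at multiples of `N`, and `G^[n]` preserves Λ.
  obtain ⟨q, hq⟩ : N ∣ (N - j) * n + 1 := by
    refine hdisj.dvd_of_iterate_mem hmaps hN (hιΛ 0) ?_
    rw [← hRT, ← hGn, ← (hιV.iterate_right n).eq]
    exact hιΛ _
  have hVn : V^[n] = (shift (1 : ℤ))^[q] := by
    funext x
    apply hιinj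
    rw [(hιV.iterate_right n).eq, (hισ.iterate_right q).eq, hGn, hq, Function.iterate_mul]
  have hdvd : n ∣ (N - j) * n + 1 :=
    hq ▸ (dvd_of_iterate_eq_iterate_shift hV hVσ (by omega) hVn).mul_left N
  have := (Nat.dvd_add_right (dvd_mul_left n (N - j))).1 hdvd
  have := Nat.le_of_dvd one_pos this
  omega
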